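/- Let $N\ge 0$ be an integer and let $a>-1$, $\theta>0$ be real. Define the partition function of the $\theta$-deformed Bures ensemble with Laguerre weight by $$Z_N^B(a;\theta)=\frac{1}{N!}\int_{\mathbb{R}_+^N}\prod_{1\le j<k\le N}\frac{x_k-x_j}{x_k+x_j}\,(x_k^\theta-x_j^\theta)\prod_{j=1}^N x_j^a e^{-x_j}\,dx_1\cdots dx_N .$$ Then the integral converges absolutely and, with $\hat\beta=\frac{a+1}{\theta}-1$, $$Z_N^B(a;\theta)=\frac{\pi^{N/2}}{\theta^{N/2}\,2^{\theta N^2+2aN-(\theta-1)N}}\prod_{j=0}^{N-1}\left(\frac{\Gamma(j+1)\,\Gamma(2\hat\beta+j+2)}{\Gamma(\theta(j+\hat\beta+1)+\tfrac12)}\sqrt{\frac{\Gamma(2\theta(\hat\beta+j+1))\,\Gamma(2\theta(\hat\beta+j+1)+1)}{\Gamma(2(\hat\beta+j+1))\,\Gamma(2(\hat\beta+j+1)+1)}}\right).$$ -/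

import Mathlib

open MeasureTheory

noncomputable section

/-- The (unnormalised) density of the `θ`-deformed Bures ensemble with Laguerre weight,
`∏_{j<k} (x_k - x_j)/(x_k + x_j) (x_k^θ - x_j^θ) ∏_j x_j^a e^{-x_j}`. -/
def buresDensity (N : ℕ) (a θ : ℝ) (x : Fin N → ℝ) : ℝ :=
  (∏ j : Fin N, ∏ k ∈ Finset.Ioi j,
      ((x k - x j) / (x k + x j)) * (x k ^ θ - x j ^ θ)) *
    ∏ j : Fin N, (x j ^ a * Real.exp (-x j))

/-- The domain of integration `ℝ₊^N`. -/
def positiveOrthant (N : ℕ) : Set (Fin N → ℝ) := {x | ∀ j, 0 < x j}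

/-- The partition function `Z_N^B(a;θ)` of the `θ`-deformed Bures ensemble. -/
def buresPartition (N : ℕ) (a θ : ℝ) : ℝ :=
  (1 / (N.factorial : ℝ)) * ∫ x in positiveOrthant N, buresDensity N a θ x

end

/-!
If `X_j` are independent gamma variables with shapes `p_j`, then the Schur product
`∏_{j<k} (X_k - X_j)/(X_k + X_j)` has expectation `∏_{j<k} (p_k - p_j)/(p_k + p_j)`. Both products
expand like Pfaffians into signed sums of products over disjoint pairs of indices, so independence
reduces the claim to a single pair, where `E[(X - Y)/(X + Y)] = (p - q)/(p + q)` follows from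
`x/(x + y) = ∫₀^∞ x e^{-tx} e^{-ty} dt`. Expanding the Vandermonde determinant in the `x_j^θ`, each
of the `N!` terms is such an expectation with shapes a permutation of `a + 1 + θ j`, and they all
agree by antisymmetry. The resulting products telescope into gamma functions, and the duplication
formula gives the stated form.
-/

section PartialFractions

variable {ι K : Type*} [DecidableEq ι] [Field K] {t : Finset ι} {x : ι → K}

open Polynomial in
lemma prod_sub_div_add_eq_one_sub_sum (hinj : Set.InjOn x t) {z : K}
    (hz : ∀ j ∈ t, z + x j ≠ 0) :
    ∏ j ∈ t, (z - x j) / (z + x j) =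
      1 - ∑ k ∈ t, 2 * x k / (z + x k) * ∏ j ∈ t.erase k, (x k + x j) / (x k - x j) := by
  -- Lagrange interpolation of `∏ (X + x j) - ∏ (X - x j)` at the nodes `x j`, evaluated at `-z`.
  set P : K[X] := ∏ j ∈ t, (X + C (x j)) with hP
  have hP_monic : P.Monic := monic_prod_of_monic _ _ fun j _ => monic_X_add_C (x j)
  have hP_degree : P.degree = t.card := by simp [hP, degree_prod]
  have hdegree : (P - Lagrange.nodal t x).degree < t.card :=
    hP_degree ▸ degree_sub_lt_left (by rw [hP_degree, Lagrange.degree_nodal]) hP_monic.ne_zero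
      (by rw [hP_monic.leadingCoeff, Lagrange.nodal_monic.leadingCoeff])
  have hz' : ∀ j ∈ t, -z ≠ x j := fun j hj h => hz j hj (by rw [← h, add_neg_cancel])
  have hnodal : (Lagrange.nodal t x).eval (-z) ≠ 0 := Lagrange.eval_nodal_not_at_node hz'
  have hquot : P.eval (-z) / (Lagrange.nodal t x).eval (-z) = ∏ j ∈ t, (z - x j) / (z + x j) := by
    simp only [hP, eval_prod, eval_add, eval_X, eval_C, Lagrange.eval_nodal,
      ← Finset.prod_div_distrib]
    exact Finset.prod_congr rfl fun j _ => by rw [← neg_div_neg_eq]; congr 1 <;> ring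
  have hterm : ∀ k ∈ t, Lagrange.nodalWeight t x k * (-z - x k)⁻¹ *
      (P - Lagrange.nodal t x).eval (x k) =
        -(2 * x k / (z + x k) * ∏ j ∈ t.erase k, (x k + x j) / (x k - x j)) := by
    intro k hk
    have hPk : P.eval (x k) = 2 * x k * ∏ j ∈ t.erase k, (x k + x j) := by
      rw [hP, eval_prod, ← Finset.mul_prod_erase t _ hk]
      simp only [eval_add, eval_X, eval_C, two_mul]
    rw [eval_sub, Lagrange.eval_nodal_at_node hk, sub_zero, hPk, Lagrange.nodalWeight,
      Finset.prod_inv_distrib, Finset.prod_div_distrib, ← neg_add', inv_neg]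
    ring
  have heval := congrArg (eval (-z)) (Lagrange.eq_interpolate hinj hdegree)
  rw [Lagrange.eval_interpolate_not_at_node _ hz', Finset.sum_congr rfl hterm,
    Finset.sum_neg_distrib, eval_sub] at heval
  rw [← hquot, div_eq_iff hnodal]
  linear_combination heval

lemma sum_prod_add_div_sub_eq_one (hinj : Set.InjOn x t) (ht : Odd t.card)
    (hx : ∀ i ∈ t, x i + x i ≠ 0) :
    ∑ k ∈ t, ∏ j ∈ t.erase k, (x k + x j) / (x k - x j) = 1 := by
  have hx0 : ∀ i ∈ t, x i ≠ 0 := fun i hi h => hx i hi (by rw [h, add_zero])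
  have htwo : (2 : K) ≠ 0 := by
    obtain ⟨i, hi⟩ := Finset.card_pos.1 ht.pos
    exact left_ne_zero_of_mul (two_mul (x i) ▸ hx i hi)
  have hprod : ∏ j ∈ t, (0 - x j) / (0 + x j) = -1 := by
    rw [← ht.neg_one_pow, ← Finset.prod_const]
    exact Finset.prod_congr rfl fun j hj => by rw [zero_sub, zero_add, neg_div, div_self (hx0 j hj)]
  have hsum := prod_sub_div_add_eq_one_sub_sum hinj (z := 0) (by simpa only [zero_add] using hx0)
  rw [hprod, Finset.sum_congr rfl fun k hk => by
    rw [zero_add, mul_div_cancel_right₀ _ (hx0 k hk)], ← Finset.mul_sum] at hsum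
  exact mul_left_cancel₀ htwo (by linear_combination hsum)

lemma prod_sub_div_add_eq_sum_of_odd (hinj : Set.InjOn x t) (ht : Odd t.card)
    (hx : ∀ i ∈ t, x i + x i ≠ 0) {z : K} (hz : ∀ j ∈ t, z + x j ≠ 0) :
    ∏ j ∈ t, (z - x j) / (z + x j) =
      ∑ k ∈ t, (z - x k) / (z + x k) * ∏ j ∈ t.erase k, (x k + x j) / (x k - x j) := by
  rw [prod_sub_div_add_eq_one_sub_sum hinj hz, ← sum_prod_add_div_sub_eq_one hinj ht hx,
    ← Finset.sum_sub_distrib]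
  refine Finset.sum_congr rfl fun k hk => ?_
  have hzk := hz k hk
  field_simp
  ring

end PartialFractions

/-- The Schur product `∏_{j<k} (x_k - x_j)/(x_k + x_j)` over pairs of indices in a finite set, which
for a set of even cardinality is Schur's Pfaffian. A pair with `x_k + x_j = 0` makes it vanish. -/
def schurProd {ι K : Type*} [LinearOrder ι] [Field K] (s : Finset ι) (x : ι → K) : K :=
  ∏ j ∈ s, ∏ k ∈ s with j < k, (x k - x j) / (x k + x j)

section SchurProd

open scoped Finset

variable {ι K : Type*} [LinearOrder ι] [Field K] {s t : Finset ι} {x : ι → K}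

lemma schurProd_map {κ : Type*} [LinearOrder κ] (f : κ ↪o ι) (s : Finset κ) (x : ι → K) :
    schurProd (s.map f.toEmbedding) x = schurProd s (x ∘ f) := by
  simp only [schurProd, Finset.prod_filter, Finset.prod_map, RelEmbedding.coe_toEmbedding,
    f.lt_iff_lt, Function.comp_apply]

lemma schurProd_univ_eq_schurProd_range (N : ℕ) (x : ℕ → K) :
    schurProd Finset.univ (fun j : Fin N => x j) = schurProd (Finset.range N) x := by
  rw [← Nat.Iio_eq_range, ← Fin.map_valEmbedding_univ]
  exact (schurProd_map (Fin.valOrderEmb N) Finset.univ x).symm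

lemma schurProd_const_mul {c : K} (hc : c ≠ 0) (s : Finset ι) (x : ι → K) :
    schurProd s (fun i => c * x i) = schurProd s x := by
  simp only [schurProd, ← mul_sub, ← mul_add, mul_div_mul_left _ _ hc]

lemma schurProd_eq_mul_schurProd_erase {k : ι} (hk : k ∈ s) (x : ι → K) :
    schurProd s x = (-1) ^ #{j ∈ s | k < j} *
      (∏ j ∈ s.erase k, (x k - x j) / (x k + x j)) * schurProd (s.erase k) x := by
  have hsign : (-1 : K) ^ #{j ∈ s | k < j} = ∏ j ∈ s.erase k, if k < j then -1 else 1 := by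
    rw [← Finset.prod_const, Finset.prod_filter, ← Finset.mul_prod_erase s _ hk,
      if_neg (lt_irrefl k), one_mul]
  have hleft : ∏ i ∈ s with k < i, (x i - x k) / (x i + x k) =
      ∏ i ∈ s.erase k, if k < i then (x i - x k) / (x i + x k) else 1 := by
    rw [Finset.prod_filter, ← Finset.mul_prod_erase s _ hk, if_neg (lt_irrefl k), one_mul]
  have hright : ∀ j ∈ s.erase k, ∏ i ∈ s with j < i, (x i - x j) / (x i + x j) =
      (if j < k then (x k - x j) / (x k + x j) else 1) *
        ∏ i ∈ s.erase k with j < i, (x i - x j) / (x i + x j) := fun j _ => by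
    rw [Finset.prod_filter, Finset.prod_filter, ← Finset.mul_prod_erase s _ hk]
  have horient : (∏ i ∈ s.erase k, if k < i then (x i - x k) / (x i + x k) else 1) *
      (∏ j ∈ s.erase k, if j < k then (x k - x j) / (x k + x j) else 1) =
      (-1) ^ #{j ∈ s | k < j} * ∏ j ∈ s.erase k, (x k - x j) / (x k + x j) := by
    rw [hsign, ← Finset.prod_mul_distrib, ← Finset.prod_mul_distrib]
    refine Finset.prod_congr rfl fun j hj => ?_
    rcases lt_or_gt_of_ne (Finset.ne_of_mem_erase hj) with hjk | hkj
    · simp only [hjk, hjk.not_gt, if_true, if_false]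
    · simp only [hkj, hkj.not_gt, if_true, if_false, add_comm (x k)]
      ring
  rw [schurProd, ← Finset.mul_prod_erase s _ hk, hleft, Finset.prod_congr rfl hright,
    Finset.prod_mul_distrib, ← mul_assoc, horient, schurProd]

lemma prod_add_div_sub_mul_schurProd (hinj : Set.InjOn x s)
    (hadd : ∀ i ∈ s, ∀ j ∈ s, x i + x j ≠ 0) {k : ι} (hk : k ∈ s) :
    (∏ j ∈ s.erase k, (x k + x j) / (x k - x j)) * schurProd s x =
      (-1) ^ #{j ∈ s | k < j} * schurProd (s.erase k) x := by
  have hcancel : (∏ j ∈ s.erase k, (x k + x j) / (x k - x j)) *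
      ∏ j ∈ s.erase k, (x k - x j) / (x k + x j) = 1 := by
    rw [← Finset.prod_mul_distrib]
    refine Finset.prod_eq_one fun j hj => ?_
    obtain ⟨hjk, hjs⟩ := Finset.mem_erase.1 hj
    have hsub : x k - x j ≠ 0 := sub_ne_zero.2 fun h => hjk (hinj hk hjs h).symm
    rw [← inv_div, inv_mul_cancel₀ (div_ne_zero hsub (hadd k hk j hjs))]
  rw [schurProd_eq_mul_schurProd_erase hk]
  linear_combination ((-1) ^ #{j ∈ s | k < j} * schurProd (s.erase k) x) * hcancel

lemma prod_sub_div_add_mul_schurProd_of_odd (hinj : Set.InjOn x t) (ht : Odd #t)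
    (hadd : ∀ i ∈ t, ∀ j ∈ t, x i + x j ≠ 0) {z : K} (hz : ∀ j ∈ t, z + x j ≠ 0) :
    (∏ j ∈ t, (z - x j) / (z + x j)) * schurProd t x =
      ∑ k ∈ t, (-1) ^ #{j ∈ t | k < j} *
        ((z - x k) / (z + x k) * schurProd (t.erase k) x) := by
  rw [prod_sub_div_add_eq_sum_of_odd hinj ht (fun i hi => hadd i hi i hi) hz, Finset.sum_mul]
  refine Finset.sum_congr rfl fun k hk => ?_
  rw [mul_assoc, prod_add_div_sub_mul_schurProd hinj hadd hk, mul_left_comm]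

lemma schurProd_eq_sum_of_odd (hinj : Set.InjOn x t) (ht : Odd #t)
    (hadd : ∀ i ∈ t, ∀ j ∈ t, x i + x j ≠ 0) :
    schurProd t x = ∑ k ∈ t, (-1) ^ #{j ∈ t | k < j} * schurProd (t.erase k) x := by
  have hsum := sum_prod_add_div_sub_eq_one hinj ht fun i hi => hadd i hi i hi
  rw [← one_mul (schurProd t x)]
  nth_rw 1 [← hsum]
  rw [Finset.sum_mul]
  exact Finset.sum_congr rfl fun k hk => prod_add_div_sub_mul_schurProd hinj hadd hk

lemma schurProd_eq_sum_of_even (hinj : Set.InjOn x s) (hs : Even #s)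
    (hadd : ∀ i ∈ s, ∀ j ∈ s, x i + x j ≠ 0) {m : ι} (hm : m ∈ s) :
    schurProd s x = (-1) ^ #{j ∈ s | m < j} *
      ∑ k ∈ s.erase m, (-1) ^ #{j ∈ s.erase m | k < j} *
        ((x m - x k) / (x m + x k) * schurProd ((s.erase m).erase k) x) := by
  have hsub : s.erase m ⊆ s := s.erase_subset m
  have hodd : Odd #(s.erase m) := by
    rw [Finset.card_erase_of_mem hm]
    exact Nat.Even.sub_odd (Finset.card_pos.2 ⟨m, hm⟩) hs odd_one
  rw [schurProd_eq_mul_schurProd_erase hm, mul_assoc,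
    prod_sub_div_add_mul_schurProd_of_odd (hinj.mono (Finset.coe_subset.2 hsub)) hodd
      (fun i hi j hj => hadd i (hsub hi) j (hsub hj)) fun j hj => hadd m hm j (hsub hj)]

lemma schurProd_univ {N : ℕ} (x : Fin N → K) :
    schurProd Finset.univ x = ∏ j, ∏ k ∈ Finset.Ioi j, (x k - x j) / (x k + x j) := by
  simp only [schurProd, Finset.filter_lt_eq_Ioi]

lemma schurProd_comp_perm {N : ℕ} (x : Fin N → K) (σ : Equiv.Perm (Fin N)) :
    schurProd Finset.univ (x ∘ σ) = Equiv.Perm.sign σ * schurProd Finset.univ x := by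
  simp only [schurProd_univ, Function.comp_apply]
  exact σ.prod_Ioi_comp_eq_sign_mul_prod (f := fun j k => (x k - x j) / (x k + x j)) fun j k => by
    rw [← neg_div, neg_sub, add_comm]

end SchurProd

section IndependentVariables

open ProbabilityTheory

variable {ι Ω : Type*} [MeasurableSpace Ω] {P : Measure Ω}

lemma ae_ne_of_indepFun {E : Type*} [MeasurableSpace E] [MeasurableEq E] [IsFiniteMeasure P]
    {μ ν : Measure E} [NullSingletonClass ν] {X Y : Ω → E} (hX : HasLaw X μ P)
    (hY : HasLaw Y ν P) (hXY : IndepFun X Y P) : ∀ᵐ ω ∂P, X ω ≠ Y ω := by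
  have := hY.isFiniteMeasure_iff.1 ‹_›
  have hdiag : MeasurableSet {z : E × E | z.1 ≠ z.2} := measurableSet_diagonal.compl
  refine ((hXY.hasLaw_prod hX hY).ae_iff (measurableSet_setOfPred.1 hdiag)).2 ?_
  rw [Measure.ae_prod_iff_ae_ae hdiag]
  exact ae_of_all _ fun x => (Measure.ae_ne ν x).mono fun y hy => hy.symm

lemma ae_injOn {E : Type*} {X : ι → Ω → E}
    (hne : Pairwise fun i j => ∀ᵐ ω ∂P, X i ω ≠ X j ω) (s : Finset ι) :
    ∀ᵐ ω ∂P, Set.InjOn (fun i => X i ω) s := by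
  filter_upwards [(Finset.eventually_all s).2 fun i _ => (Finset.eventually_all s).2
    fun j _ => Filter.eventually_imp_distrib_left.2 (hne (i := i) (j := j))] with ω hω i hi j hj hij
  exact not_imp_not.1 (hω i hi j hj) hij

lemma ae_add_ne_zero {X : ι → Ω → ℝ} (hpos : ∀ i, ∀ᵐ ω ∂P, 0 < X i ω) (s : Finset ι) :
    ∀ᵐ ω ∂P, ∀ i ∈ s, ∀ j ∈ s, X i ω + X j ω ≠ 0 := by
  filter_upwards [(Finset.eventually_all s).2 fun i _ => hpos i] with ω hω i hi j hj
  exact (add_pos (hω i hi) (hω j hj)).ne'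

lemma abs_sub_div_add_le_one {x y : ℝ} (hx : 0 < x) (hy : 0 < y) : |(x - y) / (x + y)| ≤ 1 := by
  rw [abs_div, abs_of_pos (add_pos hx hy), div_le_one (add_pos hx hy), abs_le]
  constructor <;> linarith

variable [LinearOrder ι] {X : ι → Ω → ℝ} {q : ι → ℝ}

@[fun_prop]
lemma measurable_schurProd (s : Finset ι) : Measurable fun x : ι → ℝ => schurProd s x := by
  unfold schurProd
  fun_prop

lemma aemeasurable_schurProd (hX : ∀ i, AEMeasurable (X i) P) (s : Finset ι) :
    AEMeasurable (fun ω => schurProd s fun i => X i ω) P := by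
  unfold schurProd
  fun_prop

lemma abs_schurProd_le_one {s : Finset ι} {x : ι → ℝ} (hx : ∀ i ∈ s, 0 < x i) :
    |schurProd s x| ≤ 1 := by
  simp only [schurProd, Finset.abs_prod]
  exact Finset.prod_le_one (fun _ _ => Finset.prod_nonneg fun _ _ => abs_nonneg _) fun j hj =>
    Finset.prod_le_one (fun _ _ => abs_nonneg _) fun k hk =>
      abs_sub_div_add_le_one (hx k (Finset.mem_of_mem_filter k hk)) (hx j hj)

lemma ae_abs_schurProd_le_one (hpos : ∀ i, ∀ᵐ ω ∂P, 0 < X i ω) (s : Finset ι) :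
    ∀ᵐ ω ∂P, |schurProd s fun i => X i ω| ≤ 1 :=
  ((Finset.eventually_all s).2 fun i _ => hpos i).mono fun _ hω => abs_schurProd_le_one hω

lemma integrable_schurProd [IsFiniteMeasure P] (hX : ∀ i, AEMeasurable (X i) P)
    (hpos : ∀ i, ∀ᵐ ω ∂P, 0 < X i ω) (s : Finset ι) :
    Integrable (fun ω => schurProd s fun i => X i ω) P :=
  .of_bound (aemeasurable_schurProd hX s).aestronglyMeasurable 1 (ae_abs_schurProd_le_one hpos s)

lemma integrable_sub_div_add_mul_schurProd [IsFiniteMeasure P] (hX : ∀ i, AEMeasurable (X i) P)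
    (hpos : ∀ i, ∀ᵐ ω ∂P, 0 < X i ω) (m k : ι) (s : Finset ι) :
    Integrable (fun ω => (X m ω - X k ω) / (X m ω + X k ω) * schurProd s fun i => X i ω) P :=
  (integrable_schurProd hX hpos s).bdd_mul (c := 1)
    (AEMeasurable.aestronglyMeasurable (by fun_prop))
    (by filter_upwards [hpos m, hpos k] with ω hm hk using abs_sub_div_add_le_one hm hk)

lemma integral_sub_div_add_mul_schurProd (hX : ∀ i, AEMeasurable (X i) P) (hind : iIndepFun X P)
    {m k : ι} {s : Finset ι} (hm : m ∉ s) (hk : k ∉ s) :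
    ∫ ω, (X m ω - X k ω) / (X m ω + X k ω) * schurProd s (fun i => X i ω) ∂P =
      (∫ ω, (X m ω - X k ω) / (X m ω + X k ω) ∂P) * ∫ ω, schurProd s (fun i => X i ω) ∂P := by
  have hdisj : Disjoint {m, k} s := by
    rw [Finset.disjoint_insert_left, Finset.disjoint_singleton_left]
    exact ⟨hm, hk⟩
  have hattach (ω : Ω) : schurProd s (fun i => X i ω) = schurProd s.attach fun i => X i ω := by
    conv_lhs => rw [← s.attach_map_val]
    exact schurProd_map (OrderEmbedding.subtype (· ∈ s)) s.attach _
  let m' : ({m, k} : Finset ι) := ⟨m, Finset.mem_insert_self m {k}⟩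
  let k' : ({m, k} : Finset ι) := ⟨k, Finset.mem_insert_of_mem (Finset.mem_singleton_self k)⟩
  have hφ : Measurable fun v : ({m, k} : Finset ι) → ℝ => (v m' - v k') / (v m' + v k') := by
    fun_prop
  simp only [hattach]
  exact ((hind.indepFun_finset₀ _ s hdisj hX).comp hφ
    (measurable_schurProd s.attach)).integral_fun_mul_eq_mul_integral
      (AEMeasurable.aestronglyMeasurable (hφ.comp_aemeasurable (by fun_prop)))
      (aemeasurable_schurProd (X := fun i : s => X i) (fun i => hX i) _).aestronglyMeasurable

theorem integral_schurProd_of_iIndepFun (hX : ∀ i, AEMeasurable (X i) P)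
    (hind : iIndepFun X P) (hpos : ∀ i, ∀ᵐ ω ∂P, 0 < X i ω)
    (hne : Pairwise fun i j => ∀ᵐ ω ∂P, X i ω ≠ X j ω) (hinj : q.Injective)
    (hadd : ∀ i j, q i + q j ≠ 0)
    (hmean : Pairwise fun i j =>
      ∫ ω, (X i ω - X j ω) / (X i ω + X j ω) ∂P = (q i - q j) / (q i + q j)) (s : Finset ι) :
    ∫ ω, schurProd s (fun i => X i ω) ∂P = schurProd s q := by
  have := hind.isProbabilityMeasure
  induction s using Finset.strongInduction with
  | H s ih =>
  rcases s.eq_empty_or_nonempty with rfl | ⟨m, hm⟩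
  · simp only [schurProd, Finset.prod_empty, integral_const, probReal_univ, one_smul]
  rcases Nat.even_or_odd s.card with heven | hodd
  · have hexpand := (ae_injOn hne s).and (ae_add_ne_zero hpos s) |>.mono fun ω hω =>
      schurProd_eq_sum_of_even hω.1 heven hω.2 hm
    rw [integral_congr_ae hexpand, integral_const_mul, integral_finsetSum _ fun k _ =>
      (integrable_sub_div_add_mul_schurProd hX hpos m k _).const_mul _,
      schurProd_eq_sum_of_even hinj.injOn heven (fun i _ j _ => hadd i j) hm]
    refine congrArg _ (Finset.sum_congr rfl fun k hk => ?_)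
    have hsub : (s.erase m).erase k ⊂ s :=
      (Finset.erase_subset _ _).trans_ssubset (Finset.erase_ssubset hm)
    have hm' : m ∉ (s.erase m).erase k := fun h =>
      Finset.notMem_erase m s (Finset.mem_of_mem_erase h)
    rw [integral_const_mul,
      integral_sub_div_add_mul_schurProd hX hind hm' (Finset.notMem_erase k _),
      hmean (Finset.ne_of_mem_erase hk).symm, ih _ hsub]
  · have hexpand := (ae_injOn hne s).and (ae_add_ne_zero hpos s) |>.mono fun ω hω =>
      schurProd_eq_sum_of_odd hω.1 hodd hω.2
    rw [integral_congr_ae hexpand, integral_finsetSum _ fun k _ =>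
      (integrable_schurProd hX hpos _).const_mul _,
      schurProd_eq_sum_of_odd hinj.injOn hodd fun i _ j _ => hadd i j]
    refine Finset.sum_congr rfl fun k hk => ?_
    rw [integral_const_mul, ih _ (Finset.erase_ssubset hk)]

end IndependentVariables

section GammaVariables

open ProbabilityTheory

lemma ae_pos_gammaMeasure (p r : ℝ) : ∀ᵐ x ∂gammaMeasure p r, 0 < x := by
  have hnonneg : ∀ᵐ x ∂gammaMeasure p r, 0 ≤ x := by
    rw [ae_iff]
    simp only [not_le]
    exact (withDensity_apply _ measurableSet_Iio).trans (lintegral_gammaPDF_of_nonpos le_rfl)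
  have hne : ∀ᵐ x ∂gammaMeasure p r, x ≠ 0 :=
    Measure.ae_ne (volume.withDensity (gammaPDF p r)) 0
  filter_upwards [hnonneg, hne] with x hx hx0 using hx.lt_of_ne' hx0

lemma ae_pos_prod_gammaMeasure (p q r : ℝ) :
    ∀ᵐ z ∂(gammaMeasure p r).prod (gammaMeasure q r), 0 < z.1 ∧ 0 < z.2 :=
  (Measure.quasiMeasurePreserving_fst.ae (ae_pos_gammaMeasure p r)).and
    (Measure.quasiMeasurePreserving_snd.ae (ae_pos_gammaMeasure q r))

lemma lintegral_ofReal_gammaMeasure {p r : ℝ} (hp : 0 < p) (hr : 0 < r) {f : ℝ → ℝ}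
    (hf : Measurable f) :
    ∫⁻ x, ENNReal.ofReal (f x) ∂gammaMeasure p r =
      ∫⁻ x, ENNReal.ofReal (gammaPDFReal p r x * f x) := by
  have hpdf : Measurable (gammaPDF p r) := (measurable_gammaPDFReal p r).ennreal_ofReal
  rw [gammaMeasure, lintegral_withDensity_eq_lintegral_mul _ hpdf hf.ennreal_ofReal]
  exact lintegral_congr fun x => (ENNReal.ofReal_mul (gammaPDFReal_nonneg hp hr x)).symm

lemma gammaPDFReal_mul_exp_neg_mul {p r t : ℝ} (hr : 0 < r) (ht : 0 < r + t) (x : ℝ) :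
    gammaPDFReal p r x * Real.exp (-(t * x)) = (r / (r + t)) ^ p * gammaPDFReal p (r + t) x := by
  have hpow : (r + t) ^ p ≠ 0 := (Real.rpow_pos_of_pos ht p).ne'
  unfold gammaPDFReal
  split_ifs
  · rw [add_mul, neg_add, Real.exp_add, Real.div_rpow hr.le ht.le]
    field_simp
  · ring

lemma gammaPDFReal_mul_self {p r : ℝ} (hp : 0 < p) (hr : 0 < r) (x : ℝ) :
    gammaPDFReal p r x * x = p / r * gammaPDFReal (p + 1) r x := by
  have hG := (Real.Gamma_pos_of_pos hp).ne'
  unfold gammaPDFReal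
  split_ifs with hx
  · have hxpow : x ^ (p - 1) * x = x ^ (p + 1 - 1) := by
      rw [← Real.rpow_add_one' hx (by linarith)]
      ring_nf
    rw [Real.rpow_add_one hr.ne', Real.Gamma_add_one hp.ne', ← hxpow]
    field_simp
  · ring

lemma lintegral_exp_neg_mul_gammaMeasure {p r t : ℝ} (hp : 0 < p) (hr : 0 < r) (ht : 0 < r + t) :
    ∫⁻ x, ENNReal.ofReal (Real.exp (-(t * x))) ∂gammaMeasure p r =
      ENNReal.ofReal ((r / (r + t)) ^ p) := by
  rw [lintegral_ofReal_gammaMeasure hp hr (by fun_prop)]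
  have hcoeff : 0 ≤ (r / (r + t)) ^ p := by positivity
  simp only [gammaPDFReal_mul_exp_neg_mul hr ht, ENNReal.ofReal_mul hcoeff]
  rw [lintegral_const_mul' _ _ ENNReal.ofReal_ne_top]
  exact (congrArg _ (lintegral_gammaPDF_eq_one hp ht)).trans (mul_one _)

lemma lintegral_mul_exp_neg_mul_gammaMeasure {p r t : ℝ} (hp : 0 < p) (hr : 0 < r)
    (ht : 0 < r + t) :
    ∫⁻ x, ENNReal.ofReal (x * Real.exp (-(t * x))) ∂gammaMeasure p r =
      ENNReal.ofReal (p / r * (r / (r + t)) ^ (p + 1)) := by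
  have hp1 : 0 < p + 1 := by linarith
  have hpdf (x : ℝ) : gammaPDFReal p r x * (x * Real.exp (-(t * x))) =
      p / r * (r / (r + t)) ^ (p + 1) * gammaPDFReal (p + 1) (r + t) x := by
    rw [← mul_assoc, gammaPDFReal_mul_self hp hr, mul_assoc, gammaPDFReal_mul_exp_neg_mul hr ht,
      mul_assoc]
  rw [lintegral_ofReal_gammaMeasure hp hr (by fun_prop)]
  have hcoeff : 0 ≤ p / r * (r / (r + t)) ^ (p + 1) := by positivity
  simp only [hpdf, ENNReal.ofReal_mul hcoeff]
  rw [lintegral_const_mul' _ _ ENNReal.ofReal_ne_top]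
  exact (congrArg _ (lintegral_gammaPDF_eq_one hp1 ht)).trans (mul_one _)

lemma lintegral_Ioi_mul_exp_neg_mul {x : ℝ} (hx : 0 < x) :
    ∫⁻ t in Set.Ioi (0 : ℝ), ENNReal.ofReal (x * Real.exp (-(t * x))) = 1 := by
  rw [setLIntegral_congr Ioi_ae_eq_Ici, ← lintegral_exponentialPDF_eq_one hx,
    ← lintegral_add_compl (exponentialPDF x) measurableSet_Ici, Set.compl_Ici,
    lintegral_exponentialPDF_of_nonpos le_rfl, add_zero]
  refine setLIntegral_congr_fun measurableSet_Ici fun t ht => ?_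
  rw [exponentialPDF_of_nonneg ht, mul_comm t x]

lemma ofReal_div_add_eq_lintegral {x y : ℝ} (hx : 0 < x) (hy : 0 < y) :
    ENNReal.ofReal (x / (x + y)) = ∫⁻ t in Set.Ioi (0 : ℝ),
      ENNReal.ofReal (x * Real.exp (-(t * x))) * ENNReal.ofReal (Real.exp (-(t * y))) := by
  rw [← mul_one (ENNReal.ofReal _), ← lintegral_Ioi_mul_exp_neg_mul (add_pos hx hy),
    ← lintegral_const_mul' _ _ ENNReal.ofReal_ne_top]
  refine lintegral_congr fun t => ?_
  rw [← ENNReal.ofReal_mul (by positivity), ← ENNReal.ofReal_mul (by positivity), mul_assoc,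
    ← Real.exp_add, ← mul_assoc, div_mul_cancel₀ _ (add_pos hx hy).ne']
  ring_nf

lemma lintegral_div_add_gammaMeasure {p q r : ℝ} (hp : 0 < p) (hq : 0 < q) (hr : 0 < r) :
    ∫⁻ z, ENNReal.ofReal (z.1 / (z.1 + z.2)) ∂(gammaMeasure p r).prod (gammaMeasure q r) =
      ENNReal.ofReal (p / (p + q)) := by
  have hpq : 0 < p + q := add_pos hp hq
  have := isProbabilityMeasure_gammaMeasure hp hr
  have := isProbabilityMeasure_gammaMeasure hq hr
  have := isProbabilityMeasure_gammaMeasure hpq hr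
  have hpos := ae_pos_prod_gammaMeasure p q r
  have hmoment : ∀ t ∈ Set.Ioi (0 : ℝ),
      ∫⁻ z, ENNReal.ofReal (z.1 * Real.exp (-(t * z.1))) * ENNReal.ofReal (Real.exp (-(t * z.2)))
        ∂(gammaMeasure p r).prod (gammaMeasure q r) =
      ENNReal.ofReal (p / (p + q)) *
        ∫⁻ x, ENNReal.ofReal (x * Real.exp (-(t * x))) ∂gammaMeasure (p + q) r := by
    intro t ht
    have hrt : 0 < r + t := add_pos hr ht
    rw [lintegral_prod_mul (f := fun x => ENNReal.ofReal (x * Real.exp (-(t * x))))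
        (g := fun y => ENNReal.ofReal (Real.exp (-(t * y)))) (by fun_prop) (by fun_prop),
      lintegral_mul_exp_neg_mul_gammaMeasure hp hr hrt,
      lintegral_exp_neg_mul_gammaMeasure hq hr hrt,
      lintegral_mul_exp_neg_mul_gammaMeasure hpq hr hrt, ← ENNReal.ofReal_mul (by positivity),
      ← ENNReal.ofReal_mul (by positivity), mul_assoc, ← Real.rpow_add (by positivity),
      add_right_comm]
    congr 1
    field_simp
  have hunit : ∀ᵐ x ∂gammaMeasure (p + q) r,
      ∫⁻ t in Set.Ioi (0 : ℝ), ENNReal.ofReal (x * Real.exp (-(t * x))) = 1 :=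
    (ae_pos_gammaMeasure (p + q) r).mono fun x hx => lintegral_Ioi_mul_exp_neg_mul hx
  rw [lintegral_congr_ae (hpos.mono fun z hz => ofReal_div_add_eq_lintegral hz.1 hz.2),
    lintegral_lintegral_swap (by fun_prop), setLIntegral_congr_fun measurableSet_Ioi hmoment,
    lintegral_const_mul' _ _ ENNReal.ofReal_ne_top, lintegral_lintegral_swap (by fun_prop),
    lintegral_congr_ae hunit, lintegral_one, measure_univ, mul_one]

lemma integral_sub_div_add_gammaMeasure {p q r : ℝ} (hp : 0 < p) (hq : 0 < q) (hr : 0 < r) :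
    ∫ z, (z.1 - z.2) / (z.1 + z.2) ∂(gammaMeasure p r).prod (gammaMeasure q r) =
      (p - q) / (p + q) := by
  have := isProbabilityMeasure_gammaMeasure hp hr
  have := isProbabilityMeasure_gammaMeasure hq hr
  have hpos := ae_pos_prod_gammaMeasure p q r
  have hnonneg : ∀ᵐ z ∂(gammaMeasure p r).prod (gammaMeasure q r), 0 ≤ z.1 / (z.1 + z.2) := by
    filter_upwards [hpos] with z hz
    have := hz.1
    have := hz.2
    positivity
  have hmeas : Measurable fun z : ℝ × ℝ => z.1 / (z.1 + z.2) := by fun_prop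
  have hmean : ∫ z, z.1 / (z.1 + z.2) ∂(gammaMeasure p r).prod (gammaMeasure q r) =
      p / (p + q) := by
    rw [integral_eq_lintegral_of_nonneg_ae hnonneg hmeas.aestronglyMeasurable,
      lintegral_div_add_gammaMeasure hp hq hr, ENNReal.toReal_ofReal (by positivity)]
  have hint : Integrable (fun z : ℝ × ℝ => z.1 / (z.1 + z.2))
      ((gammaMeasure p r).prod (gammaMeasure q r)) :=
    .of_integral_ne_zero (by rw [hmean]; positivity)
  have hsplit : ∀ᵐ z ∂(gammaMeasure p r).prod (gammaMeasure q r),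
      (z.1 - z.2) / (z.1 + z.2) = 2 * (z.1 / (z.1 + z.2)) - 1 := by
    filter_upwards [hpos] with z hz
    have := (add_pos hz.1 hz.2).ne'
    field_simp
    ring
  rw [integral_congr_ae hsplit, integral_sub (hint.const_mul 2) (integrable_const 1),
    integral_const_mul, hmean, integral_const, probReal_univ, one_smul]
  field_simp
  ring

lemma nullSingletonClass_gammaMeasure (p r : ℝ) : NullSingletonClass (gammaMeasure p r) :=
  inferInstanceAs (NullSingletonClass (volume.withDensity (gammaPDF p r)))

variable {ι Ω : Type*} [LinearOrder ι] [MeasurableSpace Ω] {P : Measure Ω} {X : ι → Ω → ℝ}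
  {p : ι → ℝ} {r : ℝ}

theorem integral_schurProd_gamma (hr : 0 < r) (hp : ∀ i, 0 < p i) (hinj : p.Injective)
    (hX : ∀ i, HasLaw (X i) (gammaMeasure (p i) r) P) (hind : iIndepFun X P) (s : Finset ι) :
    ∫ ω, schurProd s (fun i => X i ω) ∂P = schurProd s p := by
  have (i : ι) := nullSingletonClass_gammaMeasure (p i) r
  have := hind.isProbabilityMeasure
  refine integral_schurProd_of_iIndepFun (fun i => (hX i).aemeasurable) hind
    (fun i => ((hX i).ae_iff (p := (0 < ·)) (by fun_prop)).2 (ae_pos_gammaMeasure _ r))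
    (fun i j hij => ae_ne_of_indepFun (hX i) (hX j) (hind.indepFun hij)) hinj
    (fun i j => (add_pos (hp i) (hp j)).ne') (fun i j hij => ?_) s
  have hmeas : Measurable fun z : ℝ × ℝ => (z.1 - z.2) / (z.1 + z.2) := by fun_prop
  have hlaw := (hind.indepFun hij).hasLaw_prod (hX i) (hX j)
  exact (hlaw.integral_comp hmeas.aestronglyMeasurable).trans
    (integral_sub_div_add_gammaMeasure (hp i) (hp j) hr)

end GammaVariables

section LebesgueForm

open ProbabilityTheory

lemma pi_withDensity_ofReal {ι : Type*} [Fintype ι] {α : ι → Type*} [∀ i, MeasurableSpace (α i)]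
    {μ : ∀ i, Measure (α i)} [∀ i, SigmaFinite (μ i)] {f : ∀ i, α i → ℝ}
    (hf : ∀ i, Integrable (f i) (μ i)) (hf0 : ∀ i x, 0 ≤ f i x) :
    Measure.pi (fun i => (μ i).withDensity fun x => ENNReal.ofReal (f i x)) =
      (Measure.pi μ).withDensity fun x => ENNReal.ofReal (∏ i, f i (x i)) := by
  have (i : ι) := SigmaFinite.withDensity_ofReal (μ := μ i) (f i)
  refine Measure.pi_eq fun s hs => ?_
  have hint (i : ι) : Integrable (f i) ((μ i).restrict (s i)) := (hf i).restrict
  rw [withDensity_apply _ (MeasurableSet.univ_pi hs), Measure.restrict_pi_pi,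
    ← ofReal_integral_eq_lintegral_ofReal (Integrable.fintype_prod_dep hint)
      (ae_of_all _ fun x => Finset.prod_nonneg fun i _ => hf0 i _),
    integral_fintype_prod_eq_prod f,
    ENNReal.ofReal_prod_of_nonneg fun i _ => integral_nonneg (hf0 i)]
  refine Finset.prod_congr rfl fun i _ => ?_
  rw [withDensity_apply _ (hs i),
    ofReal_integral_eq_lintegral_ofReal (hint i) (ae_of_all _ (hf0 i))]

lemma integrable_gammaPDFReal {p r : ℝ} (hp : 0 < p) (hr : 0 < r) :
    Integrable (gammaPDFReal p r) := by
  refine ⟨(measurable_gammaPDFReal p r).aestronglyMeasurable, ?_⟩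
  rw [hasFiniteIntegral_iff_ofReal (ae_of_all _ (gammaPDFReal_nonneg hp hr))]
  exact (lintegral_gammaPDF_eq_one hp hr).trans_lt ENNReal.one_lt_top

variable {N : ℕ} {p : Fin N → ℝ}

lemma measurableSet_positiveOrthant (N : ℕ) : MeasurableSet (positiveOrthant N) := by
  unfold positiveOrthant
  measurability

lemma ae_mem_positiveOrthant {r : ℝ} (hp : ∀ i, 0 < p i) (hr : 0 < r) :
    ∀ᵐ x ∂Measure.pi fun i => gammaMeasure (p i) r, x ∈ positiveOrthant N := by
  have (i : Fin N) := isProbabilityMeasure_gammaMeasure (hp i) hr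
  exact ae_all_iff.2 fun i => Measure.tendsto_eval_ae_ae.eventually (ae_pos_gammaMeasure (p i) r)

lemma pi_gammaMeasure_eq_withDensity {r : ℝ} (hp : ∀ i, 0 < p i) (hr : 0 < r) :
    Measure.pi (fun i => gammaMeasure (p i) r) = (volume.restrict (positiveOrthant N)).withDensity
      fun x => ENNReal.ofReal (∏ i, gammaPDFReal (p i) r (x i)) := by
  rw [← Measure.restrict_eq_self_of_ae_mem (ae_mem_positiveOrthant hp hr),
    ← restrict_withDensity (measurableSet_positiveOrthant N), volume_pi]
  exact congrArg (Measure.restrict · _) (pi_withDensity_ofReal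
    (fun i => integrable_gammaPDFReal (hp i) hr) fun i => gammaPDFReal_nonneg (hp i) hr)

lemma prod_gammaPDFReal_one {x : Fin N → ℝ} (hx : x ∈ positiveOrthant N) :
    ∏ i, gammaPDFReal (p i) 1 (x i) =
      (∏ i, Real.Gamma (p i))⁻¹ * ∏ i, (x i ^ (p i - 1) * Real.exp (-x i)) := by
  rw [← Finset.prod_inv_distrib, ← Finset.prod_mul_distrib]
  refine Finset.prod_congr rfl fun i _ => ?_
  rw [gammaPDFReal, if_pos (hx i).le, Real.one_rpow, one_mul, one_div, mul_assoc]

lemma toReal_ofReal_prod_gammaPDFReal_smul (hp : ∀ i, 0 < p i) {x : Fin N → ℝ}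
    (hx : x ∈ positiveOrthant N) (y : ℝ) :
    (ENNReal.ofReal (∏ i, gammaPDFReal (p i) 1 (x i))).toReal • y =
      (∏ i, Real.Gamma (p i))⁻¹ * (y * ∏ i, (x i ^ (p i - 1) * Real.exp (-x i))) := by
  rw [ENNReal.toReal_ofReal (Finset.prod_nonneg fun i _ => gammaPDFReal_nonneg (hp i) one_pos _),
    prod_gammaPDFReal_one hx, smul_eq_mul, mul_right_comm, mul_assoc]

lemma prod_Gamma_ne_zero (hp : ∀ i, 0 < p i) : ∏ i, Real.Gamma (p i) ≠ 0 :=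
  Finset.prod_ne_zero_iff.2 fun i _ => (Real.Gamma_pos_of_pos (hp i)).ne'

lemma integrable_pi_gammaMeasure_iff (hp : ∀ i, 0 < p i) {f : (Fin N → ℝ) → ℝ} :
    Integrable f (Measure.pi fun i => gammaMeasure (p i) 1) ↔
      IntegrableOn (fun x => f x * ∏ i, (x i ^ (p i - 1) * Real.exp (-x i)))
        (positiveOrthant N) := by
  rw [pi_gammaMeasure_eq_withDensity hp one_pos, integrable_withDensity_iff_integrable_smul'
    (by fun_prop) (ae_of_all _ fun _ => ENNReal.ofReal_lt_top), ← IntegrableOn,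
    integrableOn_congr_fun (fun x hx => toReal_ofReal_prod_gammaPDFReal_smul hp hx _)
      (measurableSet_positiveOrthant N)]
  exact integrable_const_mul_iff (prod_Gamma_ne_zero hp).isUnit.inv _

lemma setIntegral_positiveOrthant_eq (hp : ∀ i, 0 < p i) (f : (Fin N → ℝ) → ℝ) :
    ∫ x in positiveOrthant N, f x * ∏ i, (x i ^ (p i - 1) * Real.exp (-x i)) =
      (∏ i, Real.Gamma (p i)) * ∫ x, f x ∂Measure.pi fun i => gammaMeasure (p i) 1 := by
  rw [pi_gammaMeasure_eq_withDensity hp one_pos, integral_withDensity_eq_integral_toReal_smul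
    (by fun_prop) (ae_of_all _ fun _ => ENNReal.ofReal_lt_top),
    setIntegral_congr_fun (measurableSet_positiveOrthant N)
      (fun x hx => toReal_ofReal_prod_gammaPDFReal_smul hp hx _), integral_const_mul,
    mul_inv_cancel_left₀ (prod_Gamma_ne_zero hp)]

lemma integrableOn_schurProd_mul (hp : ∀ i, 0 < p i) :
    IntegrableOn (fun x => schurProd Finset.univ x * ∏ i, (x i ^ (p i - 1) * Real.exp (-x i)))
      (positiveOrthant N) := by
  have (i : Fin N) := isProbabilityMeasure_gammaMeasure (hp i) one_pos
  refine (integrable_pi_gammaMeasure_iff hp).1 (integrable_schurProd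
    (fun i => (measurable_pi_apply i).aemeasurable) (fun i => ?_) Finset.univ)
  exact (ae_mem_positiveOrthant hp one_pos).mono fun x hx => hx i

lemma setIntegral_schurProd_mul (hp : ∀ i, 0 < p i) (hinj : p.Injective) :
    ∫ x in positiveOrthant N, schurProd Finset.univ x * ∏ i, (x i ^ (p i - 1) * Real.exp (-x i)) =
      (∏ i, Real.Gamma (p i)) * schurProd Finset.univ p := by
  have (i : Fin N) := isProbabilityMeasure_gammaMeasure (hp i) one_pos
  rw [setIntegral_positiveOrthant_eq hp]
  congr 1
  exact integral_schurProd_gamma one_pos hp hinj 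
    (fun i => (measurePreserving_eval (fun i => gammaMeasure (p i) 1) i).hasLaw)
    (iIndepFun_pi (X := fun _ x => x) fun _ => aemeasurable_id) Finset.univ

end LebesgueForm

section DeBruijn

variable {N : ℕ} {p : Fin N → ℝ}

lemma schurProd_mul_det_eq_sum (p x : Fin N → ℝ) :
    schurProd Finset.univ x *
        (Matrix.of fun i j => x i ^ (p j - 1) * Real.exp (-x i)).det =
      ∑ σ : Equiv.Perm (Fin N), (Equiv.Perm.sign σ : ℝ) * (schurProd Finset.univ x *
        ∏ i, (x i ^ (p (σ i) - 1) * Real.exp (-x i))) := by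
  rw [← Matrix.det_transpose, Matrix.det_apply', Finset.mul_sum]
  exact Finset.sum_congr rfl fun σ _ => mul_left_comm _ _ _

lemma integrableOn_schurProd_mul_det (hp : ∀ i, 0 < p i) :
    IntegrableOn (fun x => schurProd Finset.univ x *
      (Matrix.of fun i j => x i ^ (p j - 1) * Real.exp (-x i)).det) (positiveOrthant N) := by
  simp only [schurProd_mul_det_eq_sum]
  exact integrable_finsetSum _ fun σ _ =>
    (integrableOn_schurProd_mul (p := p ∘ σ) fun i => hp _).const_mul _

theorem setIntegral_schurProd_mul_det (hp : ∀ i, 0 < p i) (hinj : p.Injective) :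
    ∫ x in positiveOrthant N, schurProd Finset.univ x *
        (Matrix.of fun i j => x i ^ (p j - 1) * Real.exp (-x i)).det =
      N.factorial * ((∏ i, Real.Gamma (p i)) * schurProd Finset.univ p) := by
  have hterm (σ : Equiv.Perm (Fin N)) :
      ∫ x in positiveOrthant N, (Equiv.Perm.sign σ : ℝ) * (schurProd Finset.univ x *
        ∏ i, (x i ^ (p (σ i) - 1) * Real.exp (-x i))) =
      (∏ i, Real.Gamma (p i)) * schurProd Finset.univ p := by
    have hsign : (Equiv.Perm.sign σ : ℝ) * Equiv.Perm.sign σ = 1 := by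
      rw [← Int.cast_mul, Int.units_coe_mul_self, Int.cast_one]
    have hσ := setIntegral_schurProd_mul (p := p ∘ σ) (fun i => hp _) (hinj.comp σ.injective)
    simp only [Function.comp_apply] at hσ
    rw [integral_const_mul, hσ, schurProd_comp_perm, Equiv.prod_comp σ fun i => Real.Gamma (p i),
      mul_left_comm, ← mul_assoc _ _ (schurProd _ _), hsign, one_mul]
  simp only [schurProd_mul_det_eq_sum]
  rw [integral_finsetSum _ fun σ _ =>
      (integrableOn_schurProd_mul (p := fun i => p (σ i)) fun i => hp _).const_mul _,
    Finset.sum_congr rfl fun σ _ => hterm σ, Finset.sum_const, Finset.card_univ,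
    Fintype.card_perm, Fintype.card_fin, nsmul_eq_mul]

lemma buresDensity_eq_schurProd_mul_det (a θ : ℝ) {x : Fin N → ℝ} (hx : x ∈ positiveOrthant N) :
    buresDensity N a θ x = schurProd Finset.univ x * (Matrix.of fun i j : Fin N =>
      x i ^ (a + 1 + θ * (j : ℝ) - 1) * Real.exp (-x i)).det := by
  have hentry (i j : Fin N) : x i ^ (a + 1 + θ * (j : ℝ) - 1) * Real.exp (-x i) =
      x i ^ a * Real.exp (-x i) * Matrix.vandermonde (fun i => x i ^ θ) i j := by
    rw [Matrix.vandermonde_apply, ← Real.rpow_mul_natCast (hx i).le, mul_right_comm,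
      ← Real.rpow_add (hx i)]
    ring_nf
  simp only [hentry]
  rw [Matrix.det_mul_column, Matrix.det_vandermonde, schurProd_univ, buresDensity]
  simp only [Finset.prod_mul_distrib]
  ring

lemma buresExponent_pos {a θ : ℝ} (ha : -1 < a) (hθ : 0 ≤ θ) (n : ℕ) : 0 < a + 1 + θ * n := by
  have : 0 ≤ θ * n := by positivity
  linarith

lemma buresExponent_injective (N : ℕ) (a : ℝ) {θ : ℝ} (hθ : θ ≠ 0) :
    Function.Injective fun j : Fin N => a + 1 + θ * (j : ℝ) := fun _ _ h =>
  Fin.ext (Nat.cast_injective (mul_left_cancel₀ hθ (add_left_cancel h)))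

lemma integrableOn_buresDensity (N : ℕ) {a θ : ℝ} (ha : -1 < a) (hθ : 0 ≤ θ) :
    IntegrableOn (buresDensity N a θ) (positiveOrthant N) :=
  (integrableOn_schurProd_mul_det fun j => buresExponent_pos ha hθ j).congr_fun
    (fun _ hx => (buresDensity_eq_schurProd_mul_det a θ hx).symm) (measurableSet_positiveOrthant N)

theorem buresPartition_eq_schurProd (N : ℕ) {a θ : ℝ} (ha : -1 < a) (hθ : 0 < θ) :
    buresPartition N a θ = (∏ j ∈ Finset.range N, Real.Gamma (a + 1 + θ * j)) *
      schurProd (Finset.range N) fun j => a + 1 + θ * j := by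
  rw [buresPartition, setIntegral_congr_fun (measurableSet_positiveOrthant N)
      (fun x hx => buresDensity_eq_schurProd_mul_det a θ hx),
    setIntegral_schurProd_mul_det (fun j => buresExponent_pos ha hθ.le j)
      (buresExponent_injective N a hθ.ne'), one_div, inv_mul_cancel_left₀ (by positivity),
    Fin.prod_univ_eq_prod_range (fun j => Real.Gamma (a + 1 + θ * j)),
    schurProd_univ_eq_schurProd_range N fun j => a + 1 + θ * j]

end DeBruijn

section Evaluation

lemma prod_range_add_eq_Gamma_div {z : ℝ} (hz : 0 < z) (n : ℕ) :
    ∏ j ∈ Finset.range n, (z + j) = Real.Gamma (z + n) / Real.Gamma z := by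
  have hG := (Real.Gamma_pos_of_pos hz).ne'
  induction n with
  | zero => rw [Finset.prod_range_zero, Nat.cast_zero, add_zero, div_self hG]
  | succ n ih =>
    have hzn : z + n ≠ 0 := by positivity
    rw [Finset.prod_range_succ, ih, Nat.cast_succ, ← add_assoc, Real.Gamma_add_one hzn]
    ring

lemma prod_range_sub_eq_Gamma (n : ℕ) :
    ∏ j ∈ Finset.range n, ((n : ℝ) - j) = Real.Gamma (n + 1) := by
  have hreflect : ∀ j ∈ Finset.range n, (n : ℝ) - (n - 1 - j : ℕ) = 1 + j := by
    intro j hj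
    rw [Nat.sub_sub, Nat.cast_sub (by have := Finset.mem_range.1 hj; omega)]
    push_cast
    ring
  rw [← Finset.prod_range_reflect, Finset.prod_congr rfl hreflect,
    prod_range_add_eq_Gamma_div one_pos, Real.Gamma_one, div_one, add_comm]

lemma schurProd_range_succ {K : Type*} [Field K] (x : ℕ → K) (n : ℕ) :
    schurProd (Finset.range (n + 1)) x =
      schurProd (Finset.range n) x * ∏ j ∈ Finset.range n, (x n - x j) / (x n + x j) := by
  have hlast : ∏ k ∈ Finset.range (n + 1), (if n < k then (x k - x n) / (x k + x n) else 1) = 1 :=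
    Finset.prod_eq_one fun k hk => if_neg (Finset.mem_range_succ_iff.1 hk).not_gt
  simp only [schurProd, Finset.prod_filter]
  rw [Finset.prod_range_succ, hlast, mul_one, ← Finset.prod_mul_distrib]
  refine Finset.prod_congr rfl fun j hj => ?_
  rw [Finset.prod_range_succ, if_pos (Finset.mem_range.1 hj)]

lemma schurProd_range_add {b : ℝ} (hb : 0 < b) (N : ℕ) :
    schurProd (Finset.range N) (fun j => b + j) =
      ∏ j ∈ Finset.range N, Real.Gamma (j + 1) * Real.Gamma (2 * b + j) /
        Real.Gamma (2 * (b + j)) := by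
  induction N with
  | zero => simp only [schurProd, Finset.range_zero, Finset.prod_empty]
  | succ n ih =>
    have hpair : ∀ j ∈ Finset.range n,
        (b + n - (b + j)) / (b + n + (b + j)) = ((n : ℝ) - j) / (2 * b + n + j) := by
      intro j _
      ring_nf
    rw [schurProd_range_succ, ih, Finset.prod_range_succ, Finset.prod_congr rfl hpair,
      Finset.prod_div_distrib (f := fun j : ℕ => (n : ℝ) - j), prod_range_sub_eq_Gamma,
      prod_range_add_eq_Gamma_div (by positivity), div_div_eq_mul_div,
      mul_add 2 b (n : ℝ), two_mul (n : ℝ), add_assoc]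

theorem buresPartition_eq_prod_Gamma (N : ℕ) {a b θ : ℝ} (hb : 0 < b) (hθ : 0 < θ)
    (ha : a + 1 = θ * b) :
    buresPartition N a θ = ∏ j ∈ Finset.range N, Real.Gamma (θ * (b + j)) *
      (Real.Gamma (j + 1) * Real.Gamma (2 * b + j) / Real.Gamma (2 * (b + j))) := by
  have ha' : -1 < a := by linarith [mul_pos hθ hb]
  rw [buresPartition_eq_schurProd N ha' hθ, Finset.prod_mul_distrib, ← schurProd_range_add hb]
  simp only [ha, ← mul_add, schurProd_const_mul hθ.ne']

lemma sqrt_Gamma_mul_Gamma_add_one_div {θ b : ℝ} (hθ : 0 < θ) (hb : 0 < b) :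
    √(Real.Gamma (2 * θ * b) * Real.Gamma (2 * θ * b + 1) /
      (Real.Gamma (2 * b) * Real.Gamma (2 * b + 1))) =
      √θ * (Real.Gamma (2 * θ * b) / Real.Gamma (2 * b)) := by
  have : 0 < Real.Gamma (2 * θ * b) := Real.Gamma_pos_of_pos (by positivity)
  have : 0 < Real.Gamma (2 * b) := Real.Gamma_pos_of_pos (by positivity)
  have hsq : Real.Gamma (2 * θ * b) * (2 * θ * b * Real.Gamma (2 * θ * b)) /
      (Real.Gamma (2 * b) * (2 * b * Real.Gamma (2 * b))) =
      θ * (Real.Gamma (2 * θ * b) / Real.Gamma (2 * b)) ^ 2 := by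
    field_simp
  rw [Real.Gamma_add_one (by positivity), Real.Gamma_add_one (by positivity), hsq,
    Real.sqrt_mul hθ.le, Real.sqrt_sq (by positivity)]

lemma Gamma_two_mul_div_Gamma_add_half {s : ℝ} (hs : 0 < s) :
    Real.Gamma (2 * s) / Real.Gamma (s + 1 / 2) =
      2 ^ (2 * s - 1) / √Real.pi * Real.Gamma s := by
  have hG : 0 < Real.Gamma (s + 1 / 2) := Real.Gamma_pos_of_pos (by positivity)
  have hpow : (2 : ℝ) ^ (1 - 2 * s) * 2 ^ (2 * s - 1) = 1 := by
    rw [← Real.rpow_add two_pos, sub_add_sub_cancel, sub_self, Real.rpow_zero]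
  have hduplication := Real.Gamma_mul_Gamma_add_half s
  rw [div_mul_eq_mul_div, div_eq_div_iff hG.ne' (by positivity)]
  linear_combination -2 ^ (2 * s - 1) * hduplication - Real.Gamma (2 * s) * √Real.pi * hpow

lemma sqrt_Gamma_div_Gamma_add_half {θ b : ℝ} (hθ : 0 < θ) (hb : 0 < b) :
    √(Real.Gamma (2 * θ * b) * Real.Gamma (2 * θ * b + 1) /
      (Real.Gamma (2 * b) * Real.Gamma (2 * b + 1))) / Real.Gamma (θ * b + 1 / 2) =
      √θ / √Real.pi * 2 ^ (2 * (θ * b) - 1) * (Real.Gamma (θ * b) / Real.Gamma (2 * b)) := by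
  have hduplication := Gamma_two_mul_div_Gamma_add_half (mul_pos hθ hb)
  rw [sqrt_Gamma_mul_Gamma_add_one_div hθ hb, mul_assoc 2 θ b]
  linear_combination √θ / Real.Gamma (2 * b) * hduplication

lemma prod_two_rpow_eq (a θ : ℝ) (N : ℕ) :
    ∏ j ∈ Finset.range N, (2 : ℝ) ^ (2 * (a + 1 + θ * j) - 1) =
      2 ^ (θ * (N : ℝ) ^ 2 + 2 * a * N - (θ - 1) * N) := by
  induction N with
  | zero => simp
  | succ n ih =>
    rw [Finset.prod_range_succ, ih, ← Real.rpow_add two_pos]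
    push_cast
    ring_nf

lemma rpow_natCast_div_two {c : ℝ} (hc : 0 ≤ c) (N : ℕ) : c ^ ((N : ℝ) / 2) = √c ^ N := by
  rw [Real.rpow_div_two_eq_sqrt _ hc, Real.rpow_natCast]

theorem buresPartition_eq_mul_prod (N : ℕ) {a b θ : ℝ} (hb : 0 < b) (hθ : 0 < θ)
    (ha : a + 1 = θ * b) :
    buresPartition N a θ = Real.pi ^ ((N : ℝ) / 2) / (θ ^ ((N : ℝ) / 2) *
        2 ^ (θ * (N : ℝ) ^ 2 + 2 * a * N - (θ - 1) * N)) *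
      ∏ j ∈ Finset.range N,
        (Real.Gamma (j + 1) * Real.Gamma (2 * b + j) / Real.Gamma (θ * (b + j) + 1 / 2) *
          √(Real.Gamma (2 * θ * (b + j)) * Real.Gamma (2 * θ * (b + j) + 1) /
            (Real.Gamma (2 * (b + j)) * Real.Gamma (2 * (b + j) + 1)))) := by
  have hfactor : ∀ j ∈ Finset.range N,
      Real.Gamma (j + 1) * Real.Gamma (2 * b + j) / Real.Gamma (θ * (b + j) + 1 / 2) *
          √(Real.Gamma (2 * θ * (b + j)) * Real.Gamma (2 * θ * (b + j) + 1) /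
            (Real.Gamma (2 * (b + j)) * Real.Gamma (2 * (b + j) + 1))) =
        √θ / √Real.pi * 2 ^ (2 * (a + 1 + θ * j) - 1) * (Real.Gamma (θ * (b + j)) *
          (Real.Gamma (j + 1) * Real.Gamma (2 * b + j) / Real.Gamma (2 * (b + j)))) := by
    intro j _
    have hbj : 0 < b + j := add_pos_of_pos_of_nonneg hb j.cast_nonneg
    rw [div_mul_eq_mul_div, mul_div_assoc, sqrt_Gamma_div_Gamma_add_half hθ hbj, ha, mul_add]
    ring
  rw [Finset.prod_congr rfl hfactor, Finset.prod_mul_distrib, Finset.prod_mul_distrib,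
    Finset.prod_const, Finset.card_range, prod_two_rpow_eq,
    ← buresPartition_eq_prod_Gamma N hb hθ ha, rpow_natCast_div_two hθ.le,
    rpow_natCast_div_two Real.pi_pos.le, div_pow]
  field_simp

end Evaluation

theorem mainTheorem10 (N : ℕ) (a θ β : ℝ) (ha : -1 < a) (hθ : 0 < θ)
    (hβ : β = (a + 1) / θ - 1) :
    IntegrableOn (buresDensity N a θ) (positiveOrthant N) volume ∧
    buresPartition N a θ =
      Real.pi ^ ((N : ℝ) / 2) /
          (θ ^ ((N : ℝ) / 2) *
            (2 : ℝ) ^ (θ * (N : ℝ) ^ 2 + 2 * a * (N : ℝ) - (θ - 1) * (N : ℝ))) *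
        ∏ j ∈ Finset.range N,
          (Real.Gamma ((j : ℝ) + 1) * Real.Gamma (2 * β + (j : ℝ) + 2) /
              Real.Gamma (θ * ((j : ℝ) + β + 1) + 1 / 2) *
            Real.sqrt
              (Real.Gamma (2 * θ * (β + (j : ℝ) + 1)) *
                  Real.Gamma (2 * θ * (β + (j : ℝ) + 1) + 1) /
                (Real.Gamma (2 * (β + (j : ℝ) + 1)) *
                  Real.Gamma (2 * (β + (j : ℝ) + 1) + 1)))) := by
  have hβ1 : 0 < β + 1 := by
    rw [hβ, sub_add_cancel]
    exact div_pos (by linarith) hθ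
  have hexp : a + 1 = θ * (β + 1) := by
    rw [hβ, sub_add_cancel, mul_div_cancel₀ _ hθ.ne']
  refine ⟨integrableOn_buresDensity N ha hθ.le, ?_⟩
  rw [buresPartition_eq_mul_prod N hβ1 hθ hexp]
  congr 1
  refine Finset.prod_congr rfl fun j _ => ?_
  ring_nf
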